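/- Let $r$ be a positive integer. Here a digraph is simple (no loops, no parallel arcs), an oriented graph is a digraph in which no two vertices $u,v$ have both arcs $uv$ and $vu$, and it is $r$-regular if every vertex has exactly $r$ in-arcs and exactly $r$ out-arcs. A set $S$ of vertices of a digraph $D$ is acyclic if the subdigraph induced on $S$ contains no directed cycle, and $\vec\alpha(D)$ denotes the maximum size of an acyclic set in $D$. Then there exist a real number $c>0$ and an integer $n_0$, both depending only on $r$, such that for every $n\ge n_0$, if $D$ is chosen uniformly at random among all $r$-regular oriented graphs on the labelled vertex set of size $n$, then $$\mathbb P\left(\vec\alpha(D)\le \frac{2\ln r+4}{r}\,n\right)\ \ge\ 1-e^{-cn}.$$ -/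

import Mathlib

open MeasureTheory ProbabilityTheory Filter

namespace Digraph

variable {V : Type*}

/-- An oriented graph: no loops and no digons (parallel arcs are excluded by `Digraph` itself). -/
structure IsOrientedGraph (D : Digraph V) : Prop where
  loopless : ∀ v, ¬ D.Adj v v
  no_digon : ∀ v w, v ≠ w → D.Adj v w → ¬ D.Adj w v

/-- Every vertex has exactly `r` out-arcs and exactly `r` in-arcs. -/
def IsRegular [Fintype V] (D : Digraph V) (r : ℕ) : Prop :=
  ∀ v, {w | D.Adj v w}.ncard = r ∧ {w | D.Adj w v}.ncard = r

/-- A directed cycle: distinct vertices `c 0, …, c k` with arcs `c i → c (i + 1)`, where the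
addition in `Fin (k + 1)` is cyclic (for `k = 0` this is a loop, for `k = 1` a digon). -/
def HasDirectedCycle (D : Digraph V) : Prop :=
  ∃ (k : ℕ) (c : Fin (k + 1) → V), Function.Injective c ∧ ∀ i, D.Adj (c i) (c (i + 1))

/-- The subdigraph induced on the set `S`. -/
def inducedOn (D : Digraph V) (S : Set V) : Digraph S where
  Adj v w := D.Adj v w

/-- A set of vertices is acyclic if the subdigraph induced on it has no directed cycle. -/
def IsAcyclicSet (D : Digraph V) (S : Set V) : Prop :=
  ¬ (D.inducedOn S).HasDirectedCycle

open Classical in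
/-- The maximum size of an acyclic set. -/
noncomputable def acyclicNumber [Fintype V] (D : Digraph V) : ℕ :=
  (Finset.univ.filter fun S : Finset V => D.IsAcyclicSet (S : Set V)).sup Finset.card

/-- Every set of digraphs on a given vertex set is an event. -/
instance : MeasurableSpace (Digraph V) := ⊤

/-- The `r`-regular oriented graphs on the labelled vertices `0, …, n - 1`. -/
def regularOrientedGraphs (n r : ℕ) : Set (Digraph (Fin n)) :=
  {D | D.IsOrientedGraph ∧ D.IsRegular r}

/-- The uniform distribution on the `r`-regular oriented graphs on `n` labelled vertices. -/
noncomputable def uniformRegularOriented (n r : ℕ) : Measure (Digraph (Fin n)) :=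
  uniformOn (regularOrientedGraphs n r)

end Digraph

/-- The events `A n` hold with very high probability: `P n (A n) = 1 - exp (-Ω(n))` as `n → ∞`. -/
def HoldsWVHP {Ω : ℕ → Type*} [∀ n, MeasurableSpace (Ω n)]
    (P : ∀ n, Measure (Ω n)) (A : ∀ n, Set (Ω n)) : Prop :=
  ∃ c : ℝ, 0 < c ∧ ∀ᶠ n : ℕ in atTop, 1 - Real.exp (-(c * n)) ≤ (P n).real (A n)

/-! The proof is a first moment computation in the configuration model. Each vertex gets `r`
out-stubs and `r` in-stubs, a permutation `σ` of `V × Fin r` matches them, and `toDigraph σ` is the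
resulting digraph.

Passing to simple oriented graphs costs only a polynomial factor. Exchanging the heads of a bad arc
and of a far away arc lowers the number of defects, and counting such switchings from both sides
gives `factorial_card_le`. An `r`-regular oriented graph is the image of at most `(r!) ^ (2n)`
defect-free configurations, and any regular digraph is the image of at least that many
configurations (`card_fibre_le`, `le_card_fibre`), so this factor cancels in
`factorial_mul_card_le`.

An acyclic set has an ordering along which all arcs descend. Cutting the ordering into a bounded
number of blocks of size `b`, instead of keeping all of it, makes the union bound cheap: `k` blocks
can be chosen in at most `n.choose b ^ k` ways, while forbidding upward arcs between them multiplies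
the number of permutations by at most about `exp (-(k(k-1)/2) r b² / n)` (`card_perm_levels_le`,
`descFactorial_pow_mul_factorial_le`). With `k + 1` blocks and `y = b / n` the exponent is `(k + 1)
b (1 - log y - k r y / 2)`. Taking `k + 1 = ⌈log r + 2⌉` makes it negative at the threshold
(`rate_neg`), and the exponential decay absorbs the polynomial factor. -/

namespace Configuration

/-! ### Switchings: a polynomial proportion of configurations is simple. -/

open Finset

variable {X V : Type*} [Fintype X] [DecidableEq X] [DecidableEq V] (p : X → V)

/-- The out-stub `c` of the configuration `σ` gives an arc between `u` and `v`. -/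
def Joins (σ : Equiv.Perm X) (c : X) (u v : V) : Prop :=
  (p c = u ∧ p (σ c) = v) ∨ (p c = v ∧ p (σ c) = u)

instance (σ : Equiv.Perm X) (c : X) (u v : V) : Decidable (Joins p σ c u v) :=
  inferInstanceAs (Decidable (_ ∨ _))

/-- The out-stubs whose arcs are loops. -/
def loops (σ : Equiv.Perm X) : Finset X := {a | p a = p (σ a)}

/-- The out-stubs whose arcs are loops or share both ends with another arc. -/
def bad (σ : Equiv.Perm X) : Finset X :=
  {a | p a = p (σ a) ∨ ∃ c, c ≠ a ∧ Joins p σ c (p a) (p (σ a))}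

/-- The closed neighbourhood of a vertex. -/
def nbhd (σ : Equiv.Perm X) (u : V) : Finset V :=
  insert u (({a | p a = u} : Finset X).image (fun a => p (σ a)) ∪
    ({a | p a = u} : Finset X).image (fun a => p (σ.symm a)))

/-- The number of defects of a configuration; loops count twice. -/
def defect (σ : Equiv.Perm X) : ℕ := #(bad p σ) + #(loops p σ)

variable {p}

set_option linter.unusedSectionVars false

lemma mem_nbhd {σ : Equiv.Perm X} {u y : V} :
    y ∈ nbhd p σ u ↔ y = u ∨ ∃ c, Joins p σ c u y := by
  simp only [nbhd, mem_insert, mem_union, mem_image, mem_filter, mem_univ, true_and, Joins]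
  constructor
  · rintro (h | ⟨a, h1, h2⟩ | ⟨a, h1, h2⟩)
    · exact Or.inl h
    · exact Or.inr ⟨a, Or.inl ⟨h1, h2⟩⟩
    · exact Or.inr ⟨σ.symm a, Or.inr ⟨h2, by simpa using h1⟩⟩
  · rintro (h | ⟨a, ⟨h1, h2⟩ | ⟨h1, h2⟩⟩)
    · exact Or.inl h
    · exact Or.inr (Or.inl ⟨a, h1, h2⟩)
    · exact Or.inr (Or.inr ⟨σ a, h2, by simpa using h1⟩)

lemma card_nbhd_le {r : ℕ} (hp : ∀ v, #({a | p a = v} : Finset X) ≤ r)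
    (σ : Equiv.Perm X) (u : V) : #(nbhd p σ u) ≤ 2 * r + 1 := by
  refine (card_insert_le _ _).trans ?_
  have h1 := (card_image_le (s := ({a | p a = u} : Finset X)) (f := fun a => p (σ a))).trans (hp u)
  have h2 := (card_image_le (s := ({a | p a = u} : Finset X))
    (f := fun a => p (σ.symm a))).trans (hp u)
  have h3 := card_union_le (({a | p a = u} : Finset X).image (fun a => p (σ a)))
    (({a | p a = u} : Finset X).image (fun a => p (σ.symm a)))
  omega

lemma card_preimage_le {r : ℕ} (hp : ∀ v, #({a | p a = v} : Finset X) ≤ r) (W : Finset V) :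
    #({a | p a ∈ W} : Finset X) ≤ r * #W := by
  refine card_le_mul_card_image_of_maps_to (f := p) (fun a ha => by simpa using ha) r ?_
  intro v _
  exact (card_le_card fun a ha => by simpa using (mem_filter.1 ha).2).trans (hp v)

lemma card_near_le {r : ℕ} (hp : ∀ v, #({a | p a = v} : Finset X) ≤ r)
    (σ : Equiv.Perm X) (u : V) :
    #({b | p b ∈ nbhd p σ u} : Finset X) ≤ r * (2 * r + 1) :=
  (card_preimage_le hp _).trans (Nat.mul_le_mul_left _ (card_nbhd_le hp σ u))

lemma card_head_near_le {r : ℕ} (hp : ∀ v, #({a | p a = v} : Finset X) ≤ r)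
    (σ : Equiv.Perm X) (u : V) :
    #({b | p (σ b) ∈ nbhd p σ u} : Finset X) ≤ r * (2 * r + 1) := by
  refine le_trans (card_le_card_of_injOn σ ?_ σ.injective.injOn) (card_near_le hp σ u)
  intro b hb
  simpa using hb

variable (p) in
/-- The out-stubs whose arcs are far from the arc of `a`. -/
def partners (σ : Equiv.Perm X) (a : X) : Finset X :=
  {b | p (σ b) ∉ nbhd p σ (p a) ∧ p b ∉ nbhd p σ (p (σ a))}

lemma card_partners {r : ℕ} (hp : ∀ v, #({a | p a = v} : Finset X) ≤ r)
    (σ : Equiv.Perm X) (a : X) :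
    Fintype.card X ≤ #(partners p σ a) + 2 * (r * (2 * r + 1)) := by
  have h : (univ : Finset X) ⊆ partners p σ a ∪ (({b | p (σ b) ∈ nbhd p σ (p a)} : Finset X) ∪
      ({b | p b ∈ nbhd p σ (p (σ a))} : Finset X)) := by
    intro b _
    simp only [partners, mem_union, mem_filter, mem_univ, true_and]
    tauto
  have h1 := card_le_card h
  rw [card_univ] at h1
  have h2 := card_union_le (partners p σ a) (({b | p (σ b) ∈ nbhd p σ (p a)} : Finset X) ∪
      ({b | p b ∈ nbhd p σ (p (σ a))} : Finset X))
  have h3 := card_union_le ({b | p (σ b) ∈ nbhd p σ (p a)} : Finset X)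
      ({b | p b ∈ nbhd p σ (p (σ a))} : Finset X)
  have h4 := card_head_near_le hp σ (p a)
  have h5 := card_near_le hp σ (p (σ a))
  omega

section Switch

variable {σ : Equiv.Perm X} {a b : X}

lemma Joins.of_switch {c : X} {u v : V} (ha : c ≠ a) (hb : c ≠ b) :
    Joins p (σ * Equiv.swap a b) c u v ↔ Joins p σ c u v := by
  simp [Joins, Equiv.swap_apply_of_ne_of_ne ha hb]

/-- The two new arcs join pairs of distinct vertices that were not adjacent, so they make no old arc
bad. They can only conflict with each other, as a digon, and this happens only when both old arcs
were loops. The number of bad stubs may then stay the same, but loops disappear; this is why loops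
count twice. -/
lemma defect_switch_lt (ha : a ∈ bad p σ) (hb : b ∈ partners p σ a) :
    defect p (σ * Equiv.swap a b) < defect p σ := by
  set τ := σ * Equiv.swap a b with hτ
  have τa : τ a = σ b := by simp [hτ]
  have τb : τ b = σ a := by simp [hτ]
  have τc : ∀ c, c ≠ a → c ≠ b → τ c = σ c := fun c h1 h2 => by
    simp [hτ, Equiv.swap_apply_of_ne_of_ne h1 h2]
  simp only [partners, mem_filter, mem_univ, true_and, mem_nbhd, not_or, not_exists] at hb
  obtain ⟨⟨h1, h2⟩, h3, h4⟩ := hb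
  have hl : loops p τ ⊆ (loops p σ).erase a := by
    intro c hc
    simp only [loops, mem_filter, mem_univ, true_and, mem_erase] at hc ⊢
    have hca : c ≠ a := by rintro rfl; rw [τa] at hc; exact h1 hc.symm
    have hcb : c ≠ b := by rintro rfl; rw [τb] at hc; exact h3 hc
    rw [τc c hca hcb] at hc
    exact ⟨hca, hc⟩
  have hother : ∀ c, c ≠ a → c ≠ b → c ∈ bad p τ → c ∈ bad p σ := by
    intro c hca hcb hc
    simp only [bad, mem_filter, mem_univ, true_and, τc c hca hcb] at hc ⊢
    refine hc.imp_right ?_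
    rintro ⟨d, hdc, hd⟩
    by_cases hda : d = a
    · subst hda
      simp only [Joins, τa] at hd
      rcases hd with ⟨e1, e2⟩ | ⟨e1, e2⟩
      · exact (h2 c (Or.inl ⟨e1.symm, e2.symm⟩)).elim
      · exact (h2 c (Or.inr ⟨e2.symm, e1.symm⟩)).elim
    by_cases hdb : d = b
    · subst hdb
      simp only [Joins, τb] at hd
      rcases hd with ⟨e1, e2⟩ | ⟨e1, e2⟩
      · exact (h4 c (Or.inr ⟨e1.symm, e2.symm⟩)).elim
      · exact (h4 c (Or.inl ⟨e2.symm, e1.symm⟩)).elim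
    · exact ⟨d, hdc, (Joins.of_switch hda hdb).1 hd⟩
  have hboth : a ∈ bad p τ ∨ b ∈ bad p τ → p a = p (σ a) ∧ p b = p (σ b) := by
    simp only [bad, mem_filter, mem_univ, true_and, τa, τb]
    rintro ((h | ⟨c, hc, hj⟩) | (h | ⟨c, hc, hj⟩))
    · exact (h1 h.symm).elim
    · by_cases hcb : c = b
      · subst hcb
        simp only [Joins, τb] at hj
        rcases hj with ⟨e1, e2⟩ | ⟨e1, e2⟩
        · exact (h2 a (Or.inl ⟨rfl, e2⟩)).elim
        · exact ⟨e2.symm, e1⟩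
      · exact (h2 c ((Joins.of_switch hc hcb).1 hj)).elim
    · exact (h3 h).elim
    · by_cases hca : c = a
      · subst hca
        simp only [Joins, τa] at hj
        rcases hj with ⟨e1, e2⟩ | ⟨e1, e2⟩
        · exact (h2 c (Or.inl ⟨rfl, e2.symm⟩)).elim
        · exact ⟨e1, e2.symm⟩
      · have := (Joins.of_switch hca hc).1 hj
        exact (h4 c (Or.symm this)).elim
  -- Two loops may turn into a digon: here the drop comes from the loop term, otherwise from the bad
  -- term.
  by_cases hL : p a = p (σ a) ∧ p b = p (σ b)
  · have hsub : bad p τ ⊆ bad p σ := by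
      intro c hc
      by_cases hca : c = a
      · rw [hca]; exact ha
      by_cases hcb : c = b
      · subst hcb
        simp [bad, ← hL.2]
      exact hother c hca hcb hc
    have hmem : a ∈ loops p σ := by simp [loops, ← hL.1]
    have e1 := card_le_card hsub
    have e2 := (card_le_card hl).trans_lt (card_erase_lt_of_mem hmem)
    exact add_lt_add_of_le_of_lt e1 e2
  · have hsub : bad p τ ⊆ (bad p σ).erase a := by
      intro c hc
      have hca : c ≠ a := by rintro rfl; exact hL (hboth (Or.inl hc))
      have hcb : c ≠ b := by rintro rfl; exact hL (hboth (Or.inr hc))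
      exact mem_erase.2 ⟨hca, hother c hca hcb hc⟩
    have e1 := (card_le_card hsub).trans_lt (card_erase_lt_of_mem ha)
    have e2 := card_le_card (hl.trans (erase_subset _ _))
    exact add_lt_add_of_lt_of_le e1 e2

/-- Bounds the reverse switchings: whatever made `a` bad survives the switch and keeps the old head
of `a`, now the head of `b`, near `p a`. So the new configuration and `a` leave only boundedly many
candidates for `b`. -/
lemma head_mem_nbhd_switch (ha : a ∈ bad p σ) (hb : b ∈ partners p σ a) :
    p ((σ * Equiv.swap a b) b) ∈ nbhd p (σ * Equiv.swap a b) (p a) := by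
  simp only [partners, mem_filter, mem_univ, true_and, mem_nbhd, not_or, not_exists] at hb
  obtain ⟨⟨h1, h2⟩, h3, h4⟩ := hb
  simp only [bad, mem_filter, mem_univ, true_and] at ha
  rw [mem_nbhd]
  simp only [Equiv.Perm.mul_apply, Equiv.swap_apply_right]
  rcases ha with h | ⟨c, hc, hj⟩
  · exact Or.inl h.symm
  · by_cases hcb : c = b
    · subst hcb
      rcases hj with ⟨e1, e2⟩ | ⟨e1, e2⟩
      · exact (h2 c (Or.inl ⟨e1, rfl⟩)).elim
      · exact (h3 e1).elim
    · exact Or.inr ⟨c, (Joins.of_switch hc hcb).2 hj⟩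

end Switch

lemma loops_subset_bad (σ : Equiv.Perm X) : loops p σ ⊆ bad p σ := by
  intro a ha
  simp only [loops, bad, mem_filter, mem_univ, true_and] at ha ⊢
  exact Or.inl ha

lemma defect_le (σ : Equiv.Perm X) : defect p σ ≤ 2 * #(bad p σ) := by
  have := card_le_card (loops_subset_bad (p := p) σ)
  unfold defect
  omega

/-- Double counting of switchings. -/
lemma card_defect_eq_mul_le {r : ℕ} (hp : ∀ v, #({a | p a = v} : Finset X) ≤ r) (k : ℕ)
    (hX : 4 * (r * (2 * r + 1)) ≤ Fintype.card X) (hX0 : 0 < Fintype.card X) :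
    (k + 1) * #({σ | defect p σ = k + 1} : Finset (Equiv.Perm X)) ≤
      4 * (r * (2 * r + 1)) * #({σ | defect p σ ≤ k} : Finset (Equiv.Perm X)) := by
  set C := r * (2 * r + 1)
  set A : Finset (Equiv.Perm X) := {σ | defect p σ = k + 1}
  set B : Finset (Equiv.Perm X) := {σ | defect p σ ≤ k}
  let S := A.sigma fun σ => (bad p σ).sigma fun a => partners p σ a
  let T := B.sigma fun τ => (univ : Finset X).sigma fun a =>
    ({b | p (τ b) ∈ nbhd p τ (p a)} : Finset X)
  have hST : #S ≤ #T := by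
    refine card_le_card_of_injOn (fun x => ⟨x.1 * Equiv.swap x.2.1 x.2.2, x.2.1, x.2.2⟩) ?_ ?_
    · rintro ⟨σ, a, b⟩ h
      simp only [S, T, A, B, coe_sigma, Set.mem_sigma_iff, mem_coe, mem_filter, mem_univ,
        true_and] at h ⊢
      refine ⟨?_, head_mem_nbhd_switch h.2.1 h.2.2⟩
      have := defect_switch_lt h.2.1 h.2.2
      omega
    · rintro ⟨σ, a, b⟩ - ⟨σ', a', b'⟩ - h
      simp only [Sigma.mk.injEq, heq_eq_eq] at h
      obtain ⟨h1, h2⟩ := h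
      obtain ⟨rfl, rfl⟩ : a = a' ∧ b = b' := by simpa using h2
      rw [mul_left_injective _ h1]
  have hT : #T ≤ #B * (Fintype.card X * C) := by
    simp only [T, card_sigma]
    refine sum_le_card_nsmul _ _ _ fun τ _ => ?_
    refine (sum_le_card_nsmul _ _ C fun a _ => card_head_near_le hp τ (p a)).trans ?_
    simp
  have hS : #A * ((k + 1) * (Fintype.card X - 2 * C)) ≤ 2 * #S := by
    simp only [S, card_sigma, mul_sum]
    rw [← smul_eq_mul]
    refine card_nsmul_le_sum _ _ _ fun σ hσ => ?_
    have hk : defect p σ = k + 1 := by simpa [A] using hσ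
    have h2 : k + 1 ≤ 2 * #(bad p σ) := hk ▸ defect_le σ
    rw [← mul_sum]
    refine (Nat.mul_le_mul_right _ h2).trans ?_
    rw [mul_assoc]
    refine Nat.mul_le_mul_left _ ?_
    rw [← smul_eq_mul]
    refine card_nsmul_le_sum _ _ _ fun a _ => ?_
    have := card_partners hp σ a
    omega
  have hN : Fintype.card X ≤ 2 * (Fintype.card X - 2 * C) := by omega
  have := calc Fintype.card X * ((k + 1) * #A)
      ≤ 2 * (Fintype.card X - 2 * C) * ((k + 1) * #A) := Nat.mul_le_mul_right _ hN
    _ = 2 * (#A * ((k + 1) * (Fintype.card X - 2 * C))) := by ring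
    _ ≤ 2 * (2 * (#B * (Fintype.card X * C))) :=
        Nat.mul_le_mul_left _ (hS.trans (Nat.mul_le_mul_left 2 (hST.trans hT)))
    _ = Fintype.card X * (4 * C * #B) := by ring
  exact Nat.le_of_mul_le_mul_left this hX0

/-- With `M = 4r(2r + 1)`, the switching bound gives the ratio `(k + 1 + M) / (k + 1)` between
consecutive cumulative counts; these ratios telescope to a binomial coefficient, polynomial in `k`
of degree `M`. -/
lemma card_defect_le {r : ℕ} (hp : ∀ v, #({a | p a = v} : Finset X) ≤ r) (k : ℕ)
    (hX : 4 * (r * (2 * r + 1)) ≤ Fintype.card X) (hX0 : 0 < Fintype.card X) :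
    #({σ | defect p σ ≤ k} : Finset (Equiv.Perm X)) ≤
      (k + 4 * (r * (2 * r + 1))).choose (4 * (r * (2 * r + 1))) *
        #({σ | bad p σ = ∅} : Finset (Equiv.Perm X)) := by
  induction k with
  | zero =>
    simp only [zero_add, Nat.choose_self, one_mul]
    refine card_le_card fun σ hσ => ?_
    simp only [mem_filter, mem_univ, true_and, defect, nonpos_iff_eq_zero, Nat.add_eq_zero_iff,
      card_eq_zero] at hσ ⊢
    exact hσ.1
  | succ k ih =>
    set M := 4 * (r * (2 * r + 1))
    have h1 : _ ≤ M * _ := card_defect_eq_mul_le hp k hX hX0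
    have h2 : #({σ | defect p σ ≤ k + 1} : Finset (Equiv.Perm X)) ≤
        #({σ | defect p σ ≤ k} : Finset (Equiv.Perm X)) +
        #({σ | defect p σ = k + 1} : Finset (Equiv.Perm X)) := by
      refine le_trans (card_le_card fun σ hσ => ?_) (card_union_le _ _)
      simp only [mem_filter, mem_univ, true_and, mem_union] at hσ ⊢
      omega
    have h3 := Nat.choose_mul_succ_eq (k + M) M
    have h4 : k + M + 1 - M = k + 1 := by omega
    rw [h4] at h3
    refine Nat.le_of_mul_le_mul_left ?_ (Nat.succ_pos k)
    set F := #({σ | defect p σ ≤ k} : Finset (Equiv.Perm X))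
    set Z := #({σ | bad p σ = ∅} : Finset (Equiv.Perm X))
    calc (k + 1) * #({σ | defect p σ ≤ k + 1} : Finset (Equiv.Perm X))
        ≤ (k + 1) * (F + #({σ | defect p σ = k + 1} : Finset (Equiv.Perm X))) := by gcongr
      _ ≤ (k + M + 1) * F := by linarith
      _ ≤ (k + M + 1) * ((k + M).choose M * Z) := by gcongr
      _ = ((k + M).choose M * (k + M + 1)) * Z := by ring
      _ = (k + 1) * ((k + 1 + M).choose M * Z) := by
        rw [h3, show k + M + 1 = k + 1 + M by ring]; ring

/-- A polynomial proportion of the configurations has no defect. -/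
theorem factorial_card_le {r : ℕ} (hp : ∀ v, #({a | p a = v} : Finset X) ≤ r)
    (hX : 4 * (r * (2 * r + 1)) ≤ Fintype.card X) (hX0 : 0 < Fintype.card X) :
    (Fintype.card X).factorial ≤
      (2 * Fintype.card X + 4 * (r * (2 * r + 1))) ^ (4 * (r * (2 * r + 1))) *
        #({σ | bad p σ = ∅} : Finset (Equiv.Perm X)) := by
  have h := card_defect_le hp (2 * Fintype.card X) hX hX0
  rw [filter_true_of_mem, card_univ, Fintype.card_perm] at h
  · exact h.trans (Nat.mul_le_mul_right _ (Nat.choose_le_pow _ _))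
  · intro σ _
    exact (defect_le σ).trans (Nat.mul_le_mul_left _ (card_le_univ _))

end Configuration

/-! ### Counting permutations that respect levels. -/

namespace Configuration

open Finset

section Placement

variable {X Y : Type*} [DecidableEq X] [Fintype Y] [DecidableEq Y]

/-- The number of injections of `A` that send each `a` into the prescribed set `T a`. -/
noncomputable def placements (T : X → Finset Y) (A : Finset X) : ℕ :=
  #({f | ∀ a : A, f a ∈ T a} : Finset (A ↪ Y))

/-- The targets of `A` all lie in `T a`, so every placement of `A` uses up exactly `#A` of the
positions open to `a`. -/
lemma placements_insert_le (T : X → Finset Y) {A : Finset X} {a : X} (ha : a ∉ A)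
    (hT : ∀ c ∈ A, T c ⊆ T a) :
    placements T (insert a A) ≤ (#(T a) - #A) * placements T A := by
  unfold placements
  let i : A ↪ (insert a A : Finset X) :=
    ⟨fun c => ⟨c, mem_insert_of_mem c.2⟩, fun c d h => Subtype.ext (by simpa using h)⟩
  refine card_le_mul_card_image_of_maps_to (f := fun f => i.trans f) ?_ _ ?_
  · intro f hf
    simp only [mem_filter, mem_univ, true_and] at hf ⊢
    intro c
    exact hf (i c)
  · intro g hg
    simp only [mem_filter, mem_univ, true_and] at hg
    have hcard : #(T a \ univ.map g) = #(T a) - #A := by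
      rw [card_sdiff_of_subset, card_map, card_univ, Fintype.card_coe]
      intro y hy
      obtain ⟨c, -, rfl⟩ := Finset.mem_map.1 hy
      exact hT c c.2 (hg c)
    rw [← hcard]
    refine card_le_card_of_injOn (fun f => f ⟨a, mem_insert_self a A⟩) ?_ ?_
    · intro f hf
      simp only [coe_filter, mem_filter, mem_univ, true_and, Set.mem_ofPred_eq] at hf
      simp only [coe_sdiff, Set.mem_sdiff, mem_coe, Finset.mem_map, mem_univ, true_and, not_exists]
      refine ⟨hf.1 ⟨a, _⟩, fun c hc => ?_⟩
      rw [← hf.2] at hc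
      have h : (c : X) = a := congrArg Subtype.val (f.injective hc)
      exact ha (h ▸ c.2)
    · intro f hf f' hf' h
      simp only [coe_filter, mem_filter, mem_univ, true_and, Set.mem_ofPred_eq] at hf hf'
      ext ⟨c, hc⟩
      rcases mem_insert.1 hc with rfl | hc'
      · exact h
      · exact DFunLike.congr_fun (hf.2.trans hf'.2.symm) (⟨c, hc'⟩ : A)

lemma placements_union_le (T : X → Finset Y) (U : Finset Y) {A P : Finset X}
    (hd : Disjoint A P) (hA : ∀ c ∈ A, T c ⊆ U) (hP : ∀ c ∈ P, T c = U) :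
    placements T (A ∪ P) ≤ (#U - #A).descFactorial (#P) * placements T A := by
  induction P using Finset.induction_on with
  | empty => simp
  | insert x P hx ih =>
    rw [disjoint_insert_right] at hd
    have hP' : ∀ c ∈ P, T c = U := fun c hc => hP c (mem_insert_of_mem hc)
    have hxU := hP x (mem_insert_self _ _)
    have h1 := placements_insert_le T (A := A ∪ P) (a := x) (by simp [hd.1, hx]) (by
      intro c hc
      rw [hxU]
      rcases mem_union.1 hc with h | h
      · exact hA c h
      · exact (hP' c h).subset)
    rw [union_insert, card_insert_of_notMem hx, Nat.descFactorial_succ]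
    refine h1.trans ?_
    rw [hxU, card_union_of_disjoint hd.2, ← Nat.sub_sub, mul_assoc]
    exact Nat.mul_le_mul_left _ (ih hd.2 hP')

end Placement

variable {X : Type*} [Fintype X] [DecidableEq X]

/-- Fill the levels from the bottom. Level `i` may not use the `k - 1 - i` levels above it, and `i`
levels of stubs have already been placed; the two losses add up to `(k - 1) * m` for every `i`, so
each level contributes the same factor. -/
lemma placements_levels_le (φ : X → ℕ) (k m : ℕ)
    (hφ : ∀ j < k, #({a | φ a = j} : Finset X) = m) (i : ℕ) (hi : i ≤ k) :
    placements (fun a => ({y | φ y ≤ φ a ∨ k ≤ φ y} : Finset X)) ({a | φ a < i} : Finset X) ≤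
      ((Fintype.card X - (k - 1) * m).descFactorial m) ^ i := by
  have hlt : ∀ i ≤ k, #({a | φ a < i} : Finset X) = i * m := by
    intro i hi
    rw [card_eq_sum_card_fiberwise (f := φ) (t := range i) (fun a ha => by simpa using ha)]
    rw [sum_const_nat (m := m), card_range]
    intro j hj
    rw [← hφ j ((mem_range.1 hj).trans_le hi), filter_filter]
    congr 1
    ext a
    simp only [mem_filter, mem_univ, true_and]
    have := mem_range.1 hj
    omega
  induction i with
  | zero =>
    have h0 : ({a | φ a < 0} : Finset X) = ∅ := by ext; simp
    rw [h0, pow_zero]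
    exact card_le_one.2 fun f _ g _ => by ext ⟨a, ha⟩; simp at ha
  | succ i ih =>
    have hsplit : ({a | φ a < i + 1} : Finset X) =
        ({a | φ a < i} : Finset X) ∪ ({a | φ a = i} : Finset X) := by
      ext a; simp only [mem_filter, mem_univ, true_and, mem_union]; omega
    have hU : #({y | φ y ≤ i ∨ k ≤ φ y} : Finset X) = Fintype.card X - (k - 1 - i) * m := by
      have h1 := hlt (i + 1) hi
      have h2 := hlt k le_rfl
      have h3 : #({y | φ y ≤ i ∨ k ≤ φ y} : Finset X) =
          #({y | φ y < i + 1} : Finset X) + #({y | ¬ φ y < k} : Finset X) := by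
        rw [← card_union_of_disjoint]
        · congr 1
          ext y; simp only [mem_filter, mem_univ, true_and, mem_union]; omega
        · rw [disjoint_filter]; intro y _ h; omega
      have h4 := card_filter_add_card_filter_not (s := (univ : Finset X)) (fun y => φ y < k)
      rw [card_univ] at h4
      have h5 : k * m = (k - 1 - i) * m + (i + 1) * m := by
        rw [← add_mul]; congr 1; omega
      omega
    rw [hsplit]
    refine (placements_union_le _ ({y | φ y ≤ i ∨ k ≤ φ y} : Finset X) ?_ ?_ ?_).trans ?_
    · rw [disjoint_filter]; intro y _ h; omega
    · intro c hc y
      simp only [mem_filter, mem_univ, true_and] at hc ⊢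
      omega
    · intro c hc
      simp only [mem_filter, mem_univ, true_and] at hc
      simp [hc]
    · rw [hU, hφ i (by omega), hlt i (by omega), pow_succ, mul_comm]
      have : Fintype.card X - (k - 1 - i) * m - i * m = Fintype.card X - (k - 1) * m := by
        rw [Nat.sub_sub, ← add_mul]; congr 3; omega
      rw [this]
      exact Nat.mul_le_mul_right _ (ih (by omega))

/-- The number of permutations that never go up between the levels below `k`. -/
theorem card_perm_levels_le (φ : X → ℕ) (k m : ℕ)
    (hφ : ∀ j < k, #({a | φ a = j} : Finset X) = m) (hk : ∀ a, φ a ≤ k) :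
    #({σ | ∀ a, φ (σ a) ≤ φ a ∨ k ≤ φ (σ a)} : Finset (Equiv.Perm X)) ≤
      ((Fintype.card X - (k - 1) * m).descFactorial m) ^ k * (Fintype.card X - k * m).factorial := by
  set T : X → Finset X := fun a => ({y | φ y ≤ φ a ∨ k ≤ φ y} : Finset X)
  have h1 : #({σ | ∀ a, φ (σ a) ≤ φ a ∨ k ≤ φ (σ a)} : Finset (Equiv.Perm X)) ≤
      placements T univ := by
    refine card_le_card_of_injOn
      (fun σ => (Function.Embedding.subtype _).trans σ.toEmbedding) ?_ ?_
    · intro σ hσ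
      simp only [coe_filter, mem_univ, true_and, Set.mem_ofPred_eq] at hσ ⊢
      intro a
      simpa [T] using hσ a
    · intro σ _ τ _ h
      ext a
      exact DFunLike.congr_fun h (⟨a, mem_univ a⟩ : (univ : Finset X))
  have hlt : #({a | φ a < k} : Finset X) = k * m := by
    rw [card_eq_sum_card_fiberwise (f := φ) (t := range k) (fun a ha => by simpa using ha)]
    rw [sum_const_nat (m := m), card_range]
    intro j hj
    rw [← hφ j (mem_range.1 hj), filter_filter]
    congr 1
    ext a
    simp only [mem_filter, mem_univ, true_and]
    have := mem_range.1 hj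
    omega
  have h2 := placements_union_le T univ (A := ({a | φ a < k} : Finset X))
    (P := ({a | ¬ φ a < k} : Finset X)) (disjoint_filter_filter_not _ _ _) (fun _ _ => subset_univ _)
    (by
      intro c hc
      ext y
      simp only [mem_filter, mem_univ, true_and, T, iff_true] at hc ⊢
      have := hk y
      omega)
  have h3 := card_filter_add_card_filter_not (s := (univ : Finset X)) (fun y => φ y < k)
  rw [card_univ] at h3
  have h4 : #({a | ¬ φ a < k} : Finset X) = Fintype.card X - k * m := by omega
  rw [filter_union_filter_not_eq, h4, card_univ, hlt, Nat.descFactorial_self] at h2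
  refine h1.trans (h2.trans ?_)
  rw [mul_comm]
  exact Nat.mul_le_mul_right _ (placements_levels_le φ k m hφ k le_rfl)

end Configuration

/-! ### Acyclic sets, rankings and levels. -/

namespace Digraph

open Finset

variable {V : Type*}

/-- Iterating a choice of out-neighbours reaches a periodic point; its orbit over one minimal period
is the cycle. -/
lemma hasDirectedCycle_of_forall_exists_adj [Finite V] [Nonempty V] (D : Digraph V)
    (h : ∀ v, ∃ w, D.Adj v w) : D.HasDirectedCycle := by
  choose g hg using h
  obtain ⟨x, hx⟩ : ∃ x, 0 < Function.minimalPeriod g x := by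
    obtain ⟨v⟩ := ‹Nonempty V›
    obtain ⟨i, j, hij, h⟩ := Finite.exists_ne_map_eq_of_infinite (fun i => g^[i] v)
    wlog hlt : i < j generalizing i j
    · exact this j i hij.symm h.symm (by omega)
    refine ⟨g^[i] v, Function.IsPeriodicPt.minimalPeriod_pos (n := j - i) (by omega) ?_⟩
    have h' : g^[j - i] (g^[i] v) = g^[i] v := by
      rw [← Function.iterate_add_apply, Nat.sub_add_cancel hlt.le]
      exact h.symm
    exact h'
  obtain ⟨k, hk⟩ := Nat.exists_eq_succ_of_ne_zero hx.ne'
  refine ⟨k, fun i => g^[i] x, ?_, ?_⟩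
  · intro i j hij
    have := Function.iterate_injOn_Iio_minimalPeriod (f := g) (x := x)
      (by simp only [hk, Set.mem_Iio]; exact i.2) (by simp only [hk, Set.mem_Iio]; exact j.2) hij
    exact Fin.ext this
  · intro i
    have h1 : g^[((i + 1 : Fin (k + 1)) : ℕ)] x = g (g^[i] x) := by
      rw [← Function.iterate_succ_apply' g]
      by_cases hi : i = Fin.last k
      · subst hi
        have : g^[k + 1] x = x := by
          have := Function.iterate_minimalPeriod (f := g) (x := x)
          rwa [hk] at this
        simp [this]
      · rw [Fin.val_add_one_of_lt (lt_of_le_of_ne (Fin.le_last i) hi)]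
    simp only [h1]
    exact hg _

lemma IsAcyclicSet.mono {D : Digraph V} {S T : Set V} (hS : D.IsAcyclicSet S) (h : T ⊆ S) :
    D.IsAcyclicSet T := by
  rintro ⟨k, c, hc, hadj⟩
  exact hS ⟨k, fun i => ⟨c i, h (c i).2⟩, fun i j hij => hc (Subtype.ext (by simpa using hij)),
    fun i => hadj i⟩

lemma IsAcyclicSet.exists_sink {D : Digraph V} {S : Finset V} (hS : D.IsAcyclicSet (S : Set V))
    (hne : S.Nonempty) : ∃ v ∈ S, ∀ w ∈ S, ¬ D.Adj v w := by
  by_contra! h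
  have : Nonempty (S : Set V) := hne.to_subtype
  refine hS (hasDirectedCycle_of_forall_exists_adj _ ?_)
  rintro ⟨v, hv⟩
  obtain ⟨w, hw, ha⟩ := h v hv
  exact ⟨⟨w, hw⟩, ha⟩

lemma IsAcyclicSet.exists_rank [DecidableEq V] {D : Digraph V} {S : Finset V}
    (hS : D.IsAcyclicSet (S : Set V)) :
    ∃ ρ : V → ℕ, Set.BijOn ρ S (Set.Iio #S) ∧ ∀ u ∈ S, ∀ v ∈ S, D.Adj u v → ρ v < ρ u := by
  induction hn : #S generalizing S with
  | zero =>
    rw [card_eq_zero] at hn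
    subst hn
    exact ⟨fun _ => 0, by simp , by simp⟩
  | succ n ih =>
    obtain ⟨s, hs, hsink⟩ := hS.exists_sink (card_pos.1 (by omega))
    obtain ⟨ρ, hb, hρ⟩ := ih (S := S.erase s) (hS.mono (by simp))
      (by rw [card_erase_of_mem hs, hn]; rfl)
    -- The sink goes to the bottom, so arcs into it descend and none leaves it.
    refine ⟨fun v => if v = s then 0 else ρ v + 1, ⟨?_, ?_, ?_⟩, ?_⟩
    · intro v hv
      by_cases hvs : v = s
      · simp [hvs]
      · have := hb.mapsTo (show v ∈ ((S.erase s : Finset V) : Set V) by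
          simp [hvs]; exact hv)
        simpa [hvs] using this
    · intro v hv w hw h
      by_cases hvs : v = s <;> by_cases hws : w = s
      · rw [hvs, hws]
      · simp [hvs, hws] at h
      · simp [hvs, hws] at h
      · simp only [hvs, hws, if_false, Nat.add_right_cancel_iff] at h
        exact hb.injOn (by simp [hvs]; exact hv) (by simp [hws]; exact hw) h
    · rintro (_ | j) hj
      · exact ⟨s, hs, by simp⟩
      · obtain ⟨v, hv, rfl⟩ := hb.surjOn (show j ∈ Set.Iio n by simpa using hj)
        simp only [coe_erase, Set.mem_sdiff, mem_coe, Set.mem_singleton_iff] at hv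
        exact ⟨v, hv.1, by simp [hv.2]⟩
    · intro u hu v hv huv
      by_cases hus : u = s
      · subst hus; exact (hsink v hv huv).elim
      by_cases hvs : v = s
      · simp [hus, hvs]
      · simpa [hus, hvs] using hρ u (by simp [hus, hu]) v (by simp [hvs, hv]) huv

/-- A large acyclic set yields `k` levels of size `b` such that no arc goes up between them. -/
lemma IsAcyclicSet.exists_levels [Fintype V] [DecidableEq V] {D : Digraph V} {S : Finset V}
    (hS : D.IsAcyclicSet (S : Set V)) {k b : ℕ} (hb0 : 0 < b) (h : k * b ≤ #S) :
    ∃ φ : V → Fin (k + 1), (∀ j : ℕ, j < k → #({v | (φ v : ℕ) = j} : Finset V) = b) ∧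
      ∀ u v, D.Adj u v → (φ v : ℕ) ≤ φ u ∨ k ≤ (φ v : ℕ) := by
  obtain ⟨ρ, hb, hρ⟩ := hS.exists_rank
  -- Blocks of `b` consecutive ranks. The surplus of `S` and all vertices outside `S` share level
  -- `k`, on which there is no constraint.
  refine ⟨fun v => if v ∈ S then ⟨min (ρ v / b) k, by omega⟩ else Fin.last k, ?_, ?_⟩
  · intro j hj
    have hb' : (j + 1) * b ≤ k * b := Nat.mul_le_mul_right _ hj
    have hcount : #(Finset.Ico (j * b) ((j + 1) * b)) = b := by
      rw [Nat.card_Ico, ← Nat.sub_mul]; simp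
    refine (card_bij (fun v _ => ρ v) ?_ ?_ ?_).trans hcount
    · intro v hv
      simp only [mem_filter, mem_univ, true_and] at hv
      split_ifs at hv with hvS
      · simp only at hv
        have hq : ρ v / b = j := by omega
        rw [Finset.mem_Ico, ← Nat.le_div_iff_mul_le hb0, ← Nat.div_lt_iff_lt_mul hb0]
        omega
      · simp at hv; omega
    · intro v hv w hw hvw
      have key : ∀ v ∈ ({v | ((if v ∈ S then (⟨min (ρ v / b) k, by omega⟩ : Fin (k + 1))
          else Fin.last k : Fin (k + 1)) : ℕ) = j} : Finset V), v ∈ S := by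
        intro v hv
        simp only [mem_filter, mem_univ, true_and] at hv
        by_contra hvS
        simp [hvS] at hv
        omega
      exact hb.injOn (key v hv) (key w hw) hvw
    · intro i hi
      rw [Finset.mem_Ico] at hi
      obtain ⟨v, hv, rfl⟩ := hb.surjOn (show i ∈ Set.Iio #S by simp only [Set.mem_Iio]; omega)
      refine ⟨v, ?_, rfl⟩
      have : ρ v / b = j := by
        rw [← Nat.le_div_iff_mul_le hb0, ← Nat.div_lt_iff_lt_mul hb0] at hi
        omega
      simp only [mem_coe] at hv
      simp only [mem_filter, mem_univ, true_and, hv, if_true, this]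
      omega
  · intro u v huv
    by_cases hu : u ∈ S
    · by_cases hv : v ∈ S
      · left
        simp only [hu, hv, if_true]
        have := Nat.div_le_div_right (c := b) (hρ u hu v hv huv).le
        omega
      · right; simp [hv]
    · left
      simp only [hu, if_false, Fin.val_last]
      exact Nat.le_of_lt_succ (Fin.is_lt _)

lemma card_levels_le [Fintype V] [DecidableEq V] (k b : ℕ) :
    #({φ | ∀ j : ℕ, j < k → #({v | (φ v : ℕ) = j} : Finset V) = b} :
      Finset (V → Fin (k + 1))) ≤ (Fintype.card V).choose b ^ k := by
  have h : #(Fintype.piFinset fun _ : Fin k => powersetCard b (univ : Finset V)) =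
      (Fintype.card V).choose b ^ k := by simp [Fintype.card_piFinset, card_powersetCard]
  rw [← h]
  refine card_le_card_of_injOn (fun φ j => ({v | (φ v : ℕ) = j} : Finset V)) ?_ ?_
  · intro φ hφ
    simp only [coe_filter, mem_univ, true_and, Set.mem_ofPred_eq] at hφ
    simp only [mem_coe, Fintype.mem_piFinset, mem_powersetCard, subset_univ, true_and]
    exact fun j => hφ j j.2
  · intro φ _ ψ _ hφψ
    have key : ∀ (v : V) (j : Fin k), (φ v : ℕ) = j ↔ (ψ v : ℕ) = j := by
      intro v j
      have := congrFun hφψ j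
      simpa using Finset.ext_iff.1 this v
    funext v
    ext
    by_cases h1 : (φ v : ℕ) < k
    · exact ((key v ⟨_, h1⟩).1 rfl).symm
    by_cases h2 : (ψ v : ℕ) < k
    · exact (key v ⟨_, h2⟩).2 rfl
    · have := (φ v).is_lt
      have := (ψ v).is_lt
      omega

end Digraph

/-! ### From configurations to regular oriented graphs. -/

namespace Configuration

open Finset

section Projection

variable {V : Type*} {r : ℕ}

/-- The digraph obtained from a matching `σ` of out-stubs with in-stubs. -/
def toDigraph (σ : Equiv.Perm (V × Fin r)) : Digraph V where
  Adj v w := ∃ i j, σ (v, i) = (w, j)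

lemma toDigraph_adj {σ : Equiv.Perm (V × Fin r)} {v w : V} :
    (toDigraph σ).Adj v w ↔ ∃ i j, σ (v, i) = (w, j) := Iff.rfl

lemma toDigraph_adj_fst (σ : Equiv.Perm (V × Fin r)) (v : V) (i : Fin r) :
    (toDigraph σ).Adj v (σ (v, i)).1 := ⟨i, (σ (v, i)).2, rfl⟩

lemma toDigraph_adj_symm (σ : Equiv.Perm (V × Fin r)) (w : V) (j : Fin r) :
    (toDigraph σ).Adj (σ.symm (w, j)).1 w := ⟨(σ.symm (w, j)).2, j, by simp⟩

variable [Fintype V] [DecidableEq V]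

lemma out_injective {σ : Equiv.Perm (V × Fin r)} (h : bad Prod.fst σ = ∅) (v : V) :
    Function.Injective fun i => (σ (v, i)).1 := by
  intro i i' hi
  by_contra hne
  refine (Finset.eq_empty_iff_forall_notMem.1 h) (v, i) ?_
  simp only [bad, mem_filter, mem_univ, true_and]
  exact Or.inr ⟨(v, i'), by simp [Ne.symm hne], Or.inl ⟨rfl, hi.symm⟩⟩

lemma in_injective {σ : Equiv.Perm (V × Fin r)} (h : bad Prod.fst σ = ∅) (w : V) :
    Function.Injective fun j => (σ.symm (w, j)).1 := by
  intro j j' hj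
  by_contra hne
  refine (Finset.eq_empty_iff_forall_notMem.1 h) (σ.symm (w, j)) ?_
  simp only [bad, mem_filter, mem_univ, true_and]
  exact Or.inr ⟨σ.symm (w, j'), by simp [Ne.symm hne], Or.inl ⟨hj.symm, by simp⟩⟩

lemma toDigraph_isOrientedGraph {σ : Equiv.Perm (V × Fin r)} (h : bad Prod.fst σ = ∅) :
    (toDigraph σ).IsOrientedGraph := by
  have h' := Finset.eq_empty_iff_forall_notMem.1 h
  simp only [bad, mem_filter, mem_univ, true_and] at h'
  constructor
  · rintro v ⟨i, j, hij⟩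
    exact h' (v, i) (Or.inl (by rw [hij]))
  · rintro v w hvw ⟨i, j, hij⟩ ⟨i', j', hij'⟩
    exact h' (v, i) (Or.inr ⟨(w, i'), by simp [hvw.symm], Or.inr (by simp [hij, hij'])⟩)

lemma toDigraph_isRegular {σ : Equiv.Perm (V × Fin r)} (h : bad Prod.fst σ = ∅) :
    (toDigraph σ).IsRegular r := by
  intro v
  constructor
  · have : {w | (toDigraph σ).Adj v w} = Set.range fun i => (σ (v, i)).1 := by
      ext w
      simp only [Set.mem_ofPred_eq, toDigraph_adj, Set.mem_range]
      exact exists_congr fun i => ⟨fun ⟨j, hj⟩ => by rw [hj], fun hw => ⟨_, Prod.ext hw rfl⟩⟩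
    rw [this, ← Set.image_univ, Set.ncard_image_of_injective _ (out_injective h v)]
    simp
  · have : {w | (toDigraph σ).Adj w v} = Set.range fun j => (σ.symm (v, j)).1 := by
      ext w
      simp only [Set.mem_ofPred_eq, toDigraph_adj, Set.mem_range]
      rw [exists_comm]
      refine exists_congr fun j => ⟨fun ⟨i, hi⟩ => by rw [← hi]; simp, fun hw =>
        ⟨(σ.symm (v, j)).2, ?_⟩⟩
      rw [← hw]
      exact σ.apply_symm_apply (v, j)
    rw [this, ← Set.image_univ, Set.ncard_image_of_injective _ (in_injective h v)]
    simp

section Fibres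

open Classical in
lemma card_fibre_le (D : Digraph V) (hD : D.IsRegular r) :
    #({σ | bad Prod.fst σ = ∅ ∧ toDigraph σ = D} : Finset (Equiv.Perm (V × Fin r))) ≤
      r.factorial ^ Fintype.card V * r.factorial ^ Fintype.card V := by
  have hout : ∀ v, Fintype.card {w // D.Adj v w} = r := fun v => by
    rw [← (hD v).1, Set.ncard_eq_toFinset_card', Set.toFinset_card]; rfl
  have hin : ∀ w, Fintype.card {v // D.Adj v w} = r := fun w => by
    rw [← (hD w).2, Set.ncard_eq_toFinset_card', Set.toFinset_card]; rfl
  have hL : Fintype.card ((∀ v, Fin r ↪ {w // D.Adj v w}) × (∀ w, Fin r ↪ {v // D.Adj v w})) =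
      r.factorial ^ Fintype.card V * r.factorial ^ Fintype.card V := by
    simp [Fintype.card_prod, Fintype.card_pi, Fintype.card_embedding_eq, hout, hin,
      Nat.descFactorial_self]
  rw [← hL, ← Fintype.card_subtype]
  refine Fintype.card_le_of_injective (fun σ =>
    (fun v => ⟨fun i => ⟨(σ.1 (v, i)).1, by
        have := toDigraph_adj_fst σ.1 v i; rwa [σ.2.2] at this⟩,
      fun i j hij => out_injective σ.2.1 v (congrArg Subtype.val hij)⟩,
     fun w => ⟨fun j => ⟨(σ.1.symm (w, j)).1, by
        have := toDigraph_adj_symm σ.1 w j; rwa [σ.2.2] at this⟩,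
      fun i j hij => in_injective σ.2.1 w (congrArg Subtype.val hij)⟩)) ?_
  rintro ⟨σ, h1, h2⟩ ⟨τ, h3, h4⟩ h
  rw [Prod.mk.injEq] at h
  have e1 : ∀ v i, (σ (v, i)).1 = (τ (v, i)).1 := fun v i =>
    congrArg Subtype.val (DFunLike.congr_fun (congrFun h.1 v) i)
  have e2 : ∀ w j, (σ.symm (w, j)).1 = (τ.symm (w, j)).1 := fun w j =>
    congrArg Subtype.val (DFunLike.congr_fun (congrFun h.2 w) j)
  refine Subtype.ext (Equiv.ext ?_)
  rintro ⟨v, i⟩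
  refine Prod.ext (e1 v i) ?_
  refine in_injective h1 (σ (v, i)).1 ?_
  have e3 := e2 (τ (v, i)).1 (τ (v, i)).2
  simp only [Prod.mk.eta, Equiv.symm_apply_apply] at e3 ⊢
  rw [e1]
  simpa using e3.symm

open Classical in
lemma le_card_fibre (D : Digraph V) (hD : D.IsRegular r) :
    r.factorial ^ Fintype.card V * r.factorial ^ Fintype.card V ≤
      #({σ | toDigraph σ = D} : Finset (Equiv.Perm (V × Fin r))) := by
  have hout : ∀ v, Fintype.card {w // D.Adj v w} = r := fun v => by
    rw [← (hD v).1, Set.ncard_eq_toFinset_card', Set.toFinset_card]; rfl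
  have hin : ∀ w, Fintype.card {v // D.Adj v w} = r := fun w => by
    rw [← (hD w).2, Set.ncard_eq_toFinset_card', Set.toFinset_card]; rfl
  have hL : Fintype.card ((∀ v, Fin r ≃ {w // D.Adj v w}) × (∀ w, Fin r ≃ {v // D.Adj v w})) =
      r.factorial ^ Fintype.card V * r.factorial ^ Fintype.card V := by
    rw [Fintype.card_prod, Fintype.card_pi, Fintype.card_pi]
    simp_rw [fun v => Fintype.card_equiv (Fintype.equivFinOfCardEq (hout v)).symm,
      fun w => Fintype.card_equiv (Fintype.equivFinOfCardEq (hin w)).symm]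
    simp
  let g : ((∀ v, Fin r ≃ {w // D.Adj v w}) × (∀ w, Fin r ≃ {v // D.Adj v w})) →
      V × Fin r → V × Fin r := fun x a =>
    ((x.1 a.1 a.2 : V), (x.2 (x.1 a.1 a.2)).symm ⟨a.1, (x.1 a.1 a.2).2⟩)
  have gsrc : ∀ x a, ((x.2 (g x a).1 (g x a).2 : {v // D.Adj v (g x a).1}) : V) = a.1 :=
    fun x a => by simp [g]
  have ginj : ∀ x, Function.Injective (g x) := by
    intro x a a' h
    have h1 : a.1 = a'.1 := by rw [← gsrc x a, ← gsrc x a', h]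
    obtain ⟨v, i⟩ := a
    obtain ⟨v', i'⟩ := a'
    obtain rfl : v = v' := h1
    have h2 : (x.1 v i : V) = x.1 v i' := congrArg Prod.fst h
    rw [(x.1 v).injective (Subtype.ext h2)]
  let σ := fun x => Equiv.ofBijective (g x) (Finite.injective_iff_bijective.1 (ginj x))
  have hσ : ∀ x, toDigraph (σ x) = D := by
    intro x
    ext v w
    rw [toDigraph_adj]
    constructor
    · rintro ⟨i, j, hij⟩
      have : (x.1 v i : V) = w := congrArg Prod.fst hij
      exact this ▸ (x.1 v i).2
    · intro hvw
      exact ⟨(x.1 v).symm ⟨w, hvw⟩, (g x (v, (x.1 v).symm ⟨w, hvw⟩)).2,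
        Prod.ext (by simp [σ, g]) rfl⟩
  rw [← hL, ← Fintype.card_subtype]
  refine Fintype.card_le_of_injective (fun x => ⟨σ x, hσ x⟩) ?_
  intro x y hxy
  have hg : g x = g y := by
    funext a
    exact DFunLike.congr_fun (congrArg Subtype.val hxy) a
  refine Prod.ext ?_ ?_
  · funext v
    ext i
    exact congrArg Prod.fst (congrFun hg (v, i))
  · funext w
    ext j
    obtain ⟨a, ha⟩ := (σ x).surjective (w, j)
    have hx : g x a = (w, j) := ha
    have hy : g y a = (w, j) := hg ▸ ha
    have h1 := gsrc x a
    have h2 := gsrc y a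
    rw [hx] at h1
    rw [hy] at h2
    exact h1.trans h2.symm

end Fibres

open Classical in
lemma card_simple_le :
    #({σ | bad Prod.fst σ = ∅} : Finset (Equiv.Perm (V × Fin r))) ≤
      r.factorial ^ Fintype.card V * r.factorial ^ Fintype.card V *
        #({D | D.IsOrientedGraph ∧ D.IsRegular r} : Finset (Digraph V)) := by
  refine card_le_mul_card_image_of_maps_to (f := toDigraph) ?_ _ ?_
  · intro σ hσ
    simp only [mem_filter, mem_univ, true_and] at hσ ⊢
    exact ⟨toDigraph_isOrientedGraph hσ, toDigraph_isRegular hσ⟩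
  · intro D hD
    simp only [mem_filter, mem_univ, true_and] at hD
    rw [filter_filter]
    convert card_fibre_le D hD.2 using 3

open Classical in
lemma mul_card_le (B : Finset (Digraph V)) (hB : ∀ D ∈ B, D.IsRegular r) :
    r.factorial ^ Fintype.card V * r.factorial ^ Fintype.card V * #B ≤
      #({σ | toDigraph σ ∈ B} : Finset (Equiv.Perm (V × Fin r))) := by
  rw [card_eq_sum_card_fiberwise (f := toDigraph) (t := B) (fun σ hσ => by simpa using hσ),
    mul_comm, ← smul_eq_mul]
  refine card_nsmul_le_sum _ _ _ fun D hD => ?_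
  refine (le_card_fibre D (hB D hD)).trans (card_le_card fun σ hσ => ?_)
  simp only [mem_filter, mem_univ, true_and] at hσ ⊢
  exact ⟨hσ ▸ hD, hσ⟩

lemma card_fst_eq (v : V) : #({a | a.1 = v} : Finset (V × Fin r)) = r := by
  have : ({a | a.1 = v} : Finset (V × Fin r)) = {v} ×ˢ univ := by
    ext ⟨w, i⟩; simp [eq_comm]
  rw [this]; simp

omit [DecidableEq V] in
lemma card_fst_filter (P : V → Prop) [DecidablePred P] :
    #({a | P a.1} : Finset (V × Fin r)) = r * #({v | P v} : Finset V) := by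
  have : ({a | P a.1} : Finset (V × Fin r)) = ({v | P v} : Finset V) ×ˢ univ := by
    ext a; simp
  rw [this]; simp [mul_comm]

open Classical in
lemma card_large_acyclic_le (k b : ℕ) (hb : 0 < b) :
    #({σ | k * b ≤ (toDigraph σ).acyclicNumber} : Finset (Equiv.Perm (V × Fin r))) ≤
      (Fintype.card V).choose b ^ k *
        ((Fintype.card V * r - (k - 1) * (r * b)).descFactorial (r * b) ^ k *
          (Fintype.card V * r - k * (r * b)).factorial) := by
  set Φ : Finset (V → Fin (k + 1)) := {φ | ∀ j : ℕ, j < k → #({v | (φ v : ℕ) = j} : Finset V) = b}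
  have hsub : ({σ | k * b ≤ (toDigraph σ).acyclicNumber} : Finset (Equiv.Perm (V × Fin r))) ⊆
      Φ.biUnion fun φ => {σ | ∀ a, (φ (σ a).1 : ℕ) ≤ φ a.1 ∨ k ≤ (φ (σ a).1 : ℕ)} := by
    intro σ hσ
    simp only [mem_filter, mem_univ, true_and] at hσ
    have hne : (univ.filter fun S : Finset V =>
        (toDigraph σ).IsAcyclicSet (S : Set V)).Nonempty := by
      refine ⟨∅, ?_⟩
      simp only [mem_filter, mem_univ, true_and, coe_empty]
      rintro ⟨_, c, -⟩
      exact (c 0).2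
    obtain ⟨S, hS, hcard⟩ := exists_mem_eq_sup _ hne Finset.card
    simp only [mem_filter, mem_univ, true_and] at hS
    rw [Digraph.acyclicNumber, hcard] at hσ
    obtain ⟨φ, h1, h2⟩ := hS.exists_levels hb hσ
    simp only [mem_biUnion, mem_filter, mem_univ, true_and, Φ]
    refine ⟨φ, fun j hj => by convert h1 j hj, fun a => h2 _ _ (toDigraph_adj_fst σ a.1 a.2)⟩
  refine (card_le_card hsub).trans (card_biUnion_le.trans ?_)
  refine (sum_le_card_nsmul _ _ ((Fintype.card V * r - (k - 1) * (r * b)).descFactorial (r * b) ^ k *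
          (Fintype.card V * r - k * (r * b)).factorial) ?_).trans ?_
  · intro φ hφ
    simp only [mem_filter, mem_univ, true_and, Φ] at hφ
    have := card_perm_levels_le (X := V × Fin r) (fun a => (φ a.1 : ℕ)) k (r * b) (by
      intro j hj
      rw [card_fst_filter (fun v => (φ v : ℕ) = j), hφ j hj]) (fun a => by
        have := (φ a.1).is_lt; omega)
    simp only [Fintype.card_prod, Fintype.card_fin] at this
    convert this using 3
  · rw [smul_eq_mul]
    refine Nat.mul_le_mul_right _ ?_
    convert Digraph.card_levels_le (V := V) k b

end Projection

open Classical in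
lemma card_regularOriented_pos {V : Type*} [Fintype V] [DecidableEq V] {r : ℕ}
    (hX : 4 * (r * (2 * r + 1)) ≤ Fintype.card V * r) (hX0 : 0 < Fintype.card V * r) :
    0 < #({D | D.IsOrientedGraph ∧ D.IsRegular r} : Finset (Digraph V)) := by
  have h1 := factorial_card_le (X := V × Fin r) (V := V) (p := Prod.fst) (r := r)
    (fun v => (card_fst_eq v).le) (by simpa using hX) (by simpa using hX0)
  have h2 := (Nat.factorial_pos _).trans_le (h1.trans (Nat.mul_le_mul_left _ card_simple_le))
  exact Nat.pos_of_mul_pos_left (Nat.pos_of_mul_pos_left h2)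

open Classical in
/-- First moment bound for oriented regular graphs with a large acyclic set. -/
theorem factorial_mul_card_le {V : Type*} [Fintype V] [DecidableEq V] {r : ℕ} (k b : ℕ) (hb : 0 < b)
    (hX : 4 * (r * (2 * r + 1)) ≤ Fintype.card V * r) (hX0 : 0 < Fintype.card V * r) :
    (Fintype.card V * r).factorial *
      #({D | (D.IsOrientedGraph ∧ D.IsRegular r) ∧ k * b ≤ D.acyclicNumber} :
        Finset (Digraph V)) ≤
      (2 * (Fintype.card V * r) + 4 * (r * (2 * r + 1))) ^ (4 * (r * (2 * r + 1))) *
      ((Fintype.card V).choose b ^ k *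
        ((Fintype.card V * r - (k - 1) * (r * b)).descFactorial (r * b) ^ k *
          (Fintype.card V * r - k * (r * b)).factorial)) *
      #({D | D.IsOrientedGraph ∧ D.IsRegular r} : Finset (Digraph V)) := by
  set K := r.factorial ^ Fintype.card V * r.factorial ^ Fintype.card V
  set B : Finset (Digraph V) :=
    {D | (D.IsOrientedGraph ∧ D.IsRegular r) ∧ k * b ≤ D.acyclicNumber}
  have hK : 0 < K := by positivity
  have h1 := factorial_card_le (X := V × Fin r) (V := V) (p := Prod.fst) (r := r)
    (fun v => (card_fst_eq v).le) (by simpa using hX) (by simpa using hX0)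
  rw [Fintype.card_prod, Fintype.card_fin] at h1
  have h2 := card_simple_le (V := V) (r := r)
  have h3 : K * #B ≤ _ := mul_card_le (r := r) B (fun D hD => (mem_filter.1 hD).2.1.2)
  have h4 : #({σ | toDigraph σ ∈ B} : Finset (Equiv.Perm (V × Fin r))) ≤ _ :=
    (card_le_card fun σ hσ => by
      simp only [B, mem_filter, mem_univ, true_and] at hσ ⊢
      exact hσ.2).trans (card_large_acyclic_le (V := V) (r := r) k b hb)
  refine Nat.le_of_mul_le_mul_left ?_ hK
  set Q := (Fintype.card V).choose b ^ k *
        ((Fintype.card V * r - (k - 1) * (r * b)).descFactorial (r * b) ^ k *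
          (Fintype.card V * r - k * (r * b)).factorial)
  set R := #({D | D.IsOrientedGraph ∧ D.IsRegular r} : Finset (Digraph V))
  set P := (2 * (Fintype.card V * r) + 4 * (r * (2 * r + 1))) ^ (4 * (r * (2 * r + 1)))
  calc K * ((Fintype.card V * r).factorial * #B)
      = (Fintype.card V * r).factorial * (K * #B) := by ring
    _ ≤ (P * (K * R)) * Q := by
        refine Nat.mul_le_mul ?_ (h3.trans h4)
        exact h1.trans (Nat.mul_le_mul_left _ h2)
    _ = K * (P * Q * R) := by ring

end Configuration

/-! ### Exponential estimates for the first moment. -/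

section Estimates

open Real

/-- Factor by factor, `R - i ≤ (R + d - i) (1 - d / N)` because `R + d - i ≤ N`. -/
lemma descFactorial_le_mul_exp (R d m N : ℕ) (h : R + d ≤ N) (hN : 0 < N) :
    (R.descFactorial m : ℝ) ≤ (R + d).descFactorial m * exp (-(d * m / N)) := by
  have hN' : (0 : ℝ) < N := by exact_mod_cast hN
  induction m with
  | zero => simp
  | succ m ih =>
    have hstep : ((R - m : ℕ) : ℝ) ≤ ((R + d - m : ℕ) : ℝ) * exp (-(d / N)) := by
      rcases le_total R m with hm | hm
      · rw [Nat.sub_eq_zero_of_le hm]; simp only [Nat.cast_zero]; positivity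
      · rw [Nat.cast_sub hm, Nat.cast_sub (by omega : m ≤ R + d), Nat.cast_add]
        have h1 := add_one_le_exp (-(d / N : ℝ))
        have h0 : (0 : ℝ) ≤ R + d - m := by
          have : (m : ℝ) ≤ R := by exact_mod_cast hm
          have : (0 : ℝ) ≤ d := by positivity
          linarith
        have h2 : (R + d - m : ℝ) * (d / N) ≤ d := by
          rw [← mul_div_assoc, div_le_iff₀ hN', mul_comm]
          have : (R + d : ℝ) ≤ N := by exact_mod_cast h
          exact mul_le_mul_of_nonneg_left (by linarith [(Nat.cast_nonneg m : (0 : ℝ) ≤ m)])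
            (Nat.cast_nonneg d)
        calc (R - m : ℝ) ≤ (R + d - m) * (-(d / N) + 1) := by linarith
          _ ≤ _ := mul_le_mul_of_nonneg_left h1 h0
    rw [Nat.descFactorial_succ, Nat.descFactorial_succ, Nat.cast_mul, Nat.cast_mul]
    have hexp : exp (-(d * (m + 1 : ℕ) / N : ℝ)) = exp (-(d / N)) * exp (-(d * m / N)) := by
      rw [← exp_add]; congr 1; push_cast; ring
    rw [hexp]
    calc ((R - m : ℕ) : ℝ) * R.descFactorial m
        ≤ (((R + d - m : ℕ) : ℝ) * exp (-(d / N))) *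
          ((R + d).descFactorial m * exp (-(d * m / N))) := by gcongr
      _ = _ := by ring

/-- Split `(R + j * m)!` into `(R - m)!` and the falling factorials of length `m` from `R + i * m`,
`i ≤ j`. Lowering the `i`-th one to start at `R` gains `exp (-(i m² / N))`, and the gains sum to the
exponent `j(j + 1)/2 · m² / N`. -/
lemma descFactorial_pow_mul_factorial_le (R m N j : ℕ) (hm : m ≤ R) (h : R + j * m ≤ N)
    (hN : 0 < N) :
    (R.descFactorial m : ℝ) ^ (j + 1) * (R - m).factorial ≤
      (R + j * m).factorial * exp (-(j * (j + 1) / 2 * m ^ 2 / N)) := by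
  induction j with
  | zero =>
    have := Nat.factorial_mul_descFactorial hm
    simp only [zero_add, pow_one, zero_mul, add_zero, Nat.cast_zero, zero_div, neg_zero, exp_zero,
      mul_one]
    exact_mod_cast (by rw [mul_comm]; exact this.le)
  | succ j ih =>
    have hle : R + j * m ≤ N := le_trans (by gcongr; omega) h
    have h1 := descFactorial_le_mul_exp R ((j + 1) * m) m N h hN
    have h2 : ((R + j * m).factorial : ℝ) * (R + (j + 1) * m).descFactorial m =
        (R + (j + 1) * m).factorial := by
      have := Nat.factorial_mul_descFactorial (n := R + (j + 1) * m) (k := m) (by omega)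
      rw [show R + (j + 1) * m - m = R + j * m by rw [add_mul]; omega] at this
      exact_mod_cast this
    rw [pow_succ]
    calc (R.descFactorial m : ℝ) ^ (j + 1) * R.descFactorial m * (R - m).factorial
        = ((R.descFactorial m : ℝ) ^ (j + 1) * (R - m).factorial) * R.descFactorial m := by ring
      _ ≤ ((R + j * m).factorial * exp (-(j * (j + 1) / 2 * m ^ 2 / N))) *
          ((R + (j + 1) * m).descFactorial m * exp (-(((j + 1) * m : ℕ) * m / N))) := by
          exact mul_le_mul (ih hle) h1 (by positivity) (by positivity)
      _ = (R + (j + 1) * m).factorial *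
          (exp (-(j * (j + 1) / 2 * m ^ 2 / N)) * exp (-(((j + 1) * m : ℕ) * m / N))) := by
          rw [← h2]; ring
      _ = _ := by
          rw [← exp_add]; congr 2; push_cast; ring

lemma choose_le_exp (n b : ℕ) (hn : 0 < n) (hb : 0 < b) :
    (n.choose b : ℝ) ≤ exp (b * (1 - log (b / n))) := by
  have hb' : (0 : ℝ) < b := by exact_mod_cast hb
  have hn' : (0 : ℝ) < n := by exact_mod_cast hn
  have h1 : (n.choose b : ℝ) ≤ (n : ℝ) ^ b / b.factorial := Nat.choose_le_pow_div b n
  have h2 := pow_div_factorial_le_exp (b : ℝ) hb'.le b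
  have h3 : exp (b * (1 - log (b / n))) = exp b * ((n : ℝ) ^ b / (b : ℝ) ^ b) := by
    rw [mul_sub, mul_one, sub_eq_add_neg, exp_add, ← mul_neg, ← log_inv, mul_comm (b : ℝ),
      exp_mul, exp_log (by positivity), inv_div, rpow_natCast, div_pow]
  rw [h3]
  refine h1.trans ?_
  calc (n : ℝ) ^ b / b.factorial
      = ((b : ℝ) ^ b / b.factorial) * ((n : ℝ) ^ b / (b : ℝ) ^ b) := by
        field_simp
    _ ≤ _ := by gcongr

lemma firstMoment_le_exp (n r k b : ℕ) (hr : 0 < r) (hn : 0 < n) (hb : 0 < b)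
    (h : (k + 1) * b ≤ n) :
    ((n.choose b ^ (k + 1) * ((n * r - (k + 1 - 1) * (r * b)).descFactorial (r * b) ^ (k + 1) *
      (n * r - (k + 1) * (r * b)).factorial) : ℕ) : ℝ) ≤
    (n * r).factorial * exp ((k + 1) * b * (1 - log (b / n) - k * r / 2 * (b / n))) := by
  have hN : 0 < n * r := Nat.mul_pos hn hr
  have hle : (k + 1) * (r * b) ≤ n * r := by
    calc (k + 1) * (r * b) = (k + 1) * b * r := by ring
      _ ≤ n * r := Nat.mul_le_mul_right _ h
  rw [add_mul, one_mul] at hle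
  have h1 := descFactorial_pow_mul_factorial_le (n * r - k * (r * b)) (r * b) (n * r) k
    (by omega) (by omega) hN
  rw [Nat.sub_add_cancel (by omega), Nat.sub_sub] at h1
  have h2 := choose_le_exp n b hn hb
  have h3 : n * r - (k + 1) * (r * b) = n * r - (k * (r * b) + r * b) := by
    rw [add_mul, one_mul]
  rw [Nat.add_sub_cancel, h3]
  push_cast
  have hn' : (n : ℝ) ≠ 0 := by exact_mod_cast hn.ne'
  have hr' : (r : ℝ) ≠ 0 := by exact_mod_cast hr.ne'
  calc _ ≤ exp (b * (1 - log (b / n))) ^ (k + 1) * ((n * r).factorial *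
        exp (-(k * (k + 1) / 2 * (r * b : ℕ) ^ 2 / (n * r : ℕ)))) := by gcongr
    _ = (n * r).factorial * (exp ((k + 1 : ℕ) * (b * (1 - log (b / n)))) *
        exp (-(k * (k + 1) / 2 * (r * b : ℕ) ^ 2 / (n * r : ℕ)))) := by
        rw [exp_nat_mul _ (k + 1), mul_left_comm]
    _ = _ := by
        rw [← exp_add]; congr 2; push_cast; field_simp; ring

/-- The exponential rate of the first moment at the threshold is negative. -/
lemma rate_neg (r : ℕ) (hr : 0 < r) :
    ∃ k : ℕ, 1 - log ((2 * log r + 4) / r / (k + 1)) -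
      k * r / 2 * ((2 * log r + 4) / r / (k + 1)) < 0 := by
  have hr' : (1 : ℝ) ≤ r := by exact_mod_cast hr
  have hlog : 0 ≤ log (r : ℝ) := log_nonneg hr'
  set L := log (r : ℝ) + 2 with hL
  have hL0 : 0 < L := by linarith
  -- The number of levels is `k + 1 = ⌈L⌉`. With `t = L / (k + 1)` the rate becomes `t - 1 - log (2
  -- * t)`, negative because `1/2 < t ≤ 1`.
  obtain ⟨k, hk⟩ := Nat.exists_eq_succ_of_ne_zero (Nat.ceil_pos.2 hL0).ne'
  have h1 : L ≤ k + 1 := by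
    have := Nat.le_ceil L
    rw [hk] at this; push_cast at this; exact this
  have h2 : (k : ℝ) < L := by
    have := Nat.ceil_lt_add_one hL0.le
    rw [hk] at this; push_cast at this; linarith
  refine ⟨k, ?_⟩
  have hk0 : (0 : ℝ) < k + 1 := by positivity
  have e1 : (2 * log r + 4) / r / (k + 1 : ℝ) = 2 * (L / (k + 1)) / r := by
    rw [hL]; field_simp; ring
  have ht1 : L / (k + 1) ≤ 1 := (div_le_one hk0).2 h1
  have ht2 : 1 < 2 * (L / (k + 1)) := by
    rw [← mul_div_assoc, one_lt_div hk0]; linarith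
  rw [e1, log_div (by linarith) (by linarith)]
  have e2 : (k : ℝ) * r / 2 * (2 * (L / (k + 1)) / r) = L - L / (k + 1) := by
    field_simp; ring
  rw [e2]
  have := log_pos ht2
  linarith

lemma eventually_pow_mul_exp_le (a M : ℕ) {c : ℝ} (hc : 0 < c) :
    ∀ᶠ n : ℕ in atTop, ((a * n + M : ℕ) : ℝ) ^ M * exp (-(2 * c * n)) ≤ exp (-(c * n)) := by
  have h := (isLittleO_pow_exp_pos_mul_atTop M hc).comp_tendsto tendsto_natCast_atTop_atTop
  have hC : (0 : ℝ) < ((a + M + 1 : ℕ) : ℝ) ^ M := by positivity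
  filter_upwards [h.bound (inv_pos.2 hC), eventually_ge_atTop 1] with n hn h1
  simp only [Function.comp_apply, norm_pow, norm_eq_abs, abs_exp, Nat.abs_cast] at hn
  rw [inv_mul_eq_div, le_div_iff₀ hC] at hn
  have h2 : ((a * n + M : ℕ) : ℝ) ^ M ≤ exp (c * n) := by
    refine le_trans ?_ hn
    rw [← mul_pow]
    gcongr
    norm_cast
    nlinarith
  calc _ ≤ exp (c * n) * exp (-(2 * c * n)) := by gcongr
    _ = _ := by rw [← exp_add]; congr 1; ring

end Estimates

/-! ### Assembling the probability bound. -/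

lemma Digraph.acyclicNumber_le {V : Type*} [Fintype V] (D : Digraph V) :
    D.acyclicNumber ≤ Fintype.card V :=
  Finset.sup_le fun S _ => Finset.card_le_univ S

open Classical in
lemma Digraph.uniformRegularOriented_real_compl_le {n r : ℕ} {δ : ℝ} (A : Set (Digraph (Fin n)))
    (B : Finset (Digraph (Fin n))) (hB : ∀ D ∈ Aᶜ, D ∈ Digraph.regularOrientedGraphs n r → D ∈ B)
    (hpos : 0 < Finset.card {D : Digraph (Fin n) | D.IsOrientedGraph ∧ D.IsRegular r})
    (hcard : (B.card : ℝ) ≤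
      δ * Finset.card {D : Digraph (Fin n) | D.IsOrientedGraph ∧ D.IsRegular r}) :
    1 - δ ≤ (Digraph.uniformRegularOriented n r).real A := by
  set R : Finset (Digraph (Fin n)) := {D | D.IsOrientedGraph ∧ D.IsRegular r}
  have hR : Digraph.regularOrientedGraphs n r = (R : Set (Digraph (Fin n))) := by
    ext D; simp [Digraph.regularOrientedGraphs, R]
  have : MeasurableSingletonClass (Digraph (Fin n)) := ⟨fun _ => trivial⟩
  have hprob : IsProbabilityMeasure (Digraph.uniformRegularOriented n r) := by
    rw [Digraph.uniformRegularOriented, hR]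
    exact isProbabilityMeasure_uniformOn R.finite_toSet (by exact_mod_cast Finset.card_pos.1 hpos)
  have hA : MeasurableSet A := trivial
  have h2 : (Digraph.uniformRegularOriented n r).real Aᶜ ≤ δ := by
    have hfin : Aᶜ = ((Aᶜ).toFinset : Set (Digraph (Fin n))) := by simp
    rw [Digraph.uniformRegularOriented, hR, measureReal_def, hfin, uniformOn_apply_finset,
      ENNReal.toReal_div, ENNReal.toReal_natCast, ENNReal.toReal_natCast,
      div_le_iff₀ (by exact_mod_cast hpos)]
    refine le_trans ?_ hcard
    norm_cast
    refine Finset.card_le_card fun D hD => ?_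
    rw [Finset.mem_inter, Set.mem_toFinset] at hD
    exact hB D hD.2 (hR ▸ hD.1)
  have h3 := probReal_compl_eq_one_sub (μ := Digraph.uniformRegularOriented n r) hA
  linarith

theorem theorem4p1 (r : ℕ) (hr : 0 < r) :
    HoldsWVHP (fun n => Digraph.uniformRegularOriented n r)
      (fun n => {D : Digraph (Fin n) |
        (D.acyclicNumber : ℝ) ≤ (2 * Real.log r + 4) / r * n}) := by
  classical
  obtain ⟨k, hk⟩ := rate_neg r hr
  set x : ℝ := (2 * Real.log r + 4) / r with hx
  set g : ℝ → ℝ := fun y => 1 - Real.log y - k * r / 2 * y with hg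
  have hr' : (1 : ℝ) ≤ r := by exact_mod_cast hr
  have hx0 : 0 < x := by
    have := Real.log_nonneg hr'
    positivity
  set y : ℝ := x / (k + 1) with hy
  have hy0 : 0 < y := by positivity
  change g y < 0 at hk
  set M := 4 * (r * (2 * r + 1))
  -- The `8` is three factors of two: `g (b / n) < g y / 2`, `b > y * n / 2`, and half of the
  -- remaining exponent spent on the polynomial factor.
  set c : ℝ := (k + 1) * y * (-g y) / 8 with hc
  have hc0 : 0 < c := by
    have : 0 < -g y := by linarith
    positivity
  refine ⟨c, hc0, ?_⟩
  have hlim : Tendsto (fun n : ℕ => (⌊y * n⌋₊ : ℝ) / n) atTop (nhds y) :=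
    (tendsto_nat_floor_mul_div_atTop hy0.le).comp tendsto_natCast_atTop_atTop
  have hcont : ContinuousAt g y := by
    have := Real.continuousAt_log hy0.ne'
    fun_prop
  have hev1 := hlim.eventually (hcont.eventually_lt_const (show g y < g y / 2 by linarith))
  have hev2 := hlim.eventually_const_lt (show y / 2 < y by linarith)
  filter_upwards [hev1, hev2, eventually_pow_mul_exp_le (2 * r) M hc0, eventually_ge_atTop M,
    eventually_gt_atTop 0] with n hn1 hn2 hn3 hnM hn0
  set b := ⌊y * n⌋₊
  have hn' : (0 : ℝ) < n := by exact_mod_cast hn0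
  rw [lt_div_iff₀ hn'] at hn2
  have hb : 0 < b := by
    have : (0 : ℝ) < b := lt_trans (by positivity) hn2
    exact_mod_cast this
  have hbx : ((k + 1) * b : ℝ) ≤ x * n := by
    have : (b : ℝ) ≤ y * n := Nat.floor_le (by positivity)
    calc ((k + 1) * b : ℝ) ≤ (k + 1) * (y * n) := by gcongr
      _ = x * n := by rw [hy]; field_simp
  have hX : M ≤ Fintype.card (Fin n) * r := by
    rw [Fintype.card_fin]; exact hnM.trans (Nat.le_mul_of_pos_right _ hr)
  have hX0 : 0 < Fintype.card (Fin n) * r := by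
    rw [Fintype.card_fin]; exact Nat.mul_pos hn0 hr
  have hpos := Configuration.card_regularOriented_pos hX hX0
  have hmain := Configuration.factorial_mul_card_le (k + 1) b hb hX hX0
  refine Digraph.uniformRegularOriented_real_compl_le _
    {D | (D.IsOrientedGraph ∧ D.IsRegular r) ∧ (k + 1) * b ≤ D.acyclicNumber} ?_ hpos ?_
  · intro D hD hreg
    rw [Finset.mem_filter]
    refine ⟨Finset.mem_univ _, hreg, ?_⟩
    simp only [Set.mem_compl_iff, Set.mem_ofPred_eq, not_le] at hD
    exact_mod_cast (hbx.trans_lt hD).le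
  · set B : Finset (Digraph (Fin n)) :=
      {D | (D.IsOrientedGraph ∧ D.IsRegular r) ∧ (k + 1) * b ≤ D.acyclicNumber}
    -- For small `r` the threshold may exceed `n`; a member of `B` supplies the bound `(k + 1) * b ≤
    -- n` that the first moment estimate needs.
    rcases B.eq_empty_or_nonempty with hB | ⟨D, hD⟩
    · rw [hB]; simp only [Finset.card_empty, Nat.cast_zero]; positivity
    have hkn : (k + 1) * b ≤ n := by
      have := (Finset.mem_filter.1 hD).2.2.trans D.acyclicNumber_le
      rwa [Fintype.card_fin] at this
    rw [Fintype.card_fin] at hmain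
    have hfm := firstMoment_le_exp n r k b hr hn0 hb hkn
    set Q := n.choose b ^ (k + 1) * ((n * r - (k + 1 - 1) * (r * b)).descFactorial (r * b) ^ (k + 1) *
      (n * r - (k + 1) * (r * b)).factorial)
    set R := Finset.card {D : Digraph (Fin n) | D.IsOrientedGraph ∧ D.IsRegular r}
    have hexp : ((k + 1) * b * (1 - Real.log (b / n) - k * r / 2 * (b / n)) : ℝ) ≤
        -(2 * c * n) := by
      change ((k + 1) * b * g (b / n) : ℝ) ≤ _
      calc ((k + 1) * b * g (b / n) : ℝ) ≤ (k + 1) * b * (g y / 2) := by gcongr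
        _ ≤ (k + 1) * (y / 2 * n) * (g y / 2) :=
          mul_le_mul_of_nonpos_right (by gcongr) (by linarith)
        _ = -(2 * c * n) := by rw [hc]; ring
    have hP : 2 * (n * r) + M = 2 * r * n + M := by ring
    rw [hP] at hmain
    have hF : (0 : ℝ) < (n * r).factorial := by exact_mod_cast Nat.factorial_pos _
    refine le_of_mul_le_mul_left ?_ hF
    calc ((n * r).factorial : ℝ) * B.card
        ≤ ((2 * r * n + M : ℕ) : ℝ) ^ M * (Q : ℝ) * R := by exact_mod_cast hmain
      _ ≤ ((2 * r * n + M : ℕ) : ℝ) ^ M * ((n * r).factorial * Real.exp (-(2 * c * n))) * R := by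
          gcongr
          exact hfm.trans (by gcongr)
      _ = (n * r).factorial * ((((2 * r * n + M : ℕ) : ℝ) ^ M * Real.exp (-(2 * c * n))) * R) := by
          ring
      _ ≤ _ := by gcongr
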